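/- Let $L$ be a compact Hausdorff space. A \emph{Banach bundle} over $L$ is a topological space $E$ (not necessarily Hausdorff) together with a continuous open surjection $p\colon E\to L$ such that: (i) every fiber $E_l=p^{-1}(l)$ is a complex Banach space; (ii) addition $E\times_L E\to E$ and scalar multiplication $\mathbb C\times E\to E$ are continuous; (iii) the norm $\|\cdot\|\colon E\to[0,\infty)$ is upper semicontinuous; (iv) for each $l\in L$ the sets $\{e\in E\mid p(e)\in U,\ \|e\|<\varepsilon\}$, with $U$ a neighborhood of $l$ and $\varepsilon>0$, form a neighborhood base of $0_l\in E_l$ in $E$. It is \emph{locally trivial} if for each $l\in L$ there are a compact neighborhood $W$ of $l$, $n\in\mathbb N_0$, a homeomorphism $\Phi\colon p^{-1}(W)\to W\times\mathbb C^n$ and constants $c_1,c_2>0$ such that $\mathrm{pr}_1\circ\Phi=p$ on $p^{-1}(W)$, the restriction $\Phi|_{E_w}\colon E_w\to\{w\}\times\mathbb C^n$ is an isomorphism of vector spaces for every $w\in W$, and $c_1\|e\|\le\|\mathrm{pr}_2(\Phi(e))\|\le c_2\|e\|$ for every $e\in p^{-1}(W)$. Let $\mathrm C(L)$ be the algebra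 of continuous complex-valued functions on $L$, and let $\Gamma(E)=\{\sigma\colon L\to E \text{ continuous}\mid p\circ\sigma=\mathrm{id}_L\}$ be the space of continuous sections, a $\mathrm C(L)$-module under the pointwise operations. \textbf{Proposition.} For a Banach bundle $E$ over a compact Hausdorff space $L$ the following assertions are equivalent: (a) $E$ is locally trivial; (b) $\Gamma(E)$ is a finitely generated and projective $\mathrm C(L)$-module. -/

import Mathlib

open scoped Topology

noncomputable section

/-- The total space (disjoint union) of a family of fibers `E l`, `l : L`, with its projection
`Bundle.TotalSpace.proj` onto `L`. (Mathlib's `Bundle.TotalSpace` carries an unused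
model-fiber argument, which is set to `Unit`.) -/
abbrev BundleSpace {L : Type*} (E : L → Type*) := Bundle.TotalSpace Unit E

namespace BundleSpace

variable {L : Type*} {E : L → Type*}

/-- The projection of the total space onto the base. -/
abbrev proj (e : BundleSpace E) : L := Bundle.TotalSpace.proj e

/-- The point of the total space given by a vector `v` in the fiber over `l`. -/
abbrev point (l : L) (v : E l) : BundleSpace E := Bundle.TotalSpace.mk l v

variable (E) in
/-- The fiber product `E ×_L E`: a base point together with two vectors of its fiber. -/
structure FiberProduct where
  base : L
  fst : E base
  snd : E base

/-- `E ×_L E` carries the subspace topology of `E × E`. -/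
instance [TopologicalSpace (BundleSpace E)] : TopologicalSpace (FiberProduct E) :=
  TopologicalSpace.induced
    (fun q => ((point q.base q.fst, point q.base q.snd) : BundleSpace E × BundleSpace E))
    inferInstance

end BundleSpace

open BundleSpace

/-- A family of complex Banach spaces `E l`, `l : L`, with a topology on its total space, is a
Banach bundle over `L` (with upper semicontinuous norm). The topology on the total space is
not assumed to be Hausdorff. -/
class BanachBundle {L : Type*} [TopologicalSpace L] (E : L → Type*)
    [∀ l, NormedAddCommGroup (E l)] [∀ l, NormedSpace ℂ (E l)] [∀ l, CompleteSpace (E l)]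
    [TopologicalSpace (BundleSpace E)] : Prop where
  continuous_proj : Continuous (proj : BundleSpace E → L)
  isOpenMap_proj : IsOpenMap (proj : BundleSpace E → L)
  surjective_proj : Function.Surjective (proj : BundleSpace E → L)
  continuous_add :
    Continuous (fun q : FiberProduct E => (point q.base (q.fst + q.snd) : BundleSpace E))
  continuous_smul :
    Continuous (fun q : ℂ × BundleSpace E => (point q.2.proj (q.1 • q.2.snd) : BundleSpace E))
  upperSemicontinuous_norm : UpperSemicontinuous (fun e : BundleSpace E => ‖e.snd‖)
  hasBasis_nhds_zero : ∀ l : L, (𝓝 (point l (0 : E l))).HasBasis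
    (fun Uε : Set L × ℝ => Uε.1 ∈ 𝓝 l ∧ 0 < Uε.2)
    (fun Uε => {e : BundleSpace E | e.proj ∈ Uε.1 ∧ ‖e.snd‖ < Uε.2})

namespace BanachBundle

variable {L : Type*} [TopologicalSpace L] (E : L → Type*)
  [∀ l, NormedAddCommGroup (E l)] [∀ l, NormedSpace ℂ (E l)] [∀ l, CompleteSpace (E l)]
  [TopologicalSpace (BundleSpace E)]

/-- Local triviality of a Banach bundle: near every point the bundle is, over a compact
neighborhood `W`, homeomorphic to `W × ℂⁿ` (with `n` depending on the point), compatibly with the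
projections, linearly isomorphically on fibers, and with uniform norm bounds. -/
def LocallyTrivial : Prop :=
  ∀ l : L, ∃ W : Set L, IsCompact W ∧ W ∈ 𝓝 l ∧
    ∃ (n : ℕ) (Φ : {e : BundleSpace E // e.proj ∈ W} ≃ₜ W × EuclideanSpace ℂ (Fin n)),
      (∀ e, (Φ e).1 = ⟨e.1.proj, e.2⟩) ∧
      (∀ w : W, ∃ A : E w ≃ₗ[ℂ] EuclideanSpace ℂ (Fin n),
        ∀ v : E w, (Φ ⟨point w.1 v, w.2⟩).2 = A v) ∧
      ∃ c₁ c₂ : ℝ, 0 < c₁ ∧ 0 < c₂ ∧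
        ∀ e, c₁ * ‖e.1.snd‖ ≤ ‖(Φ e).2‖ ∧ ‖(Φ e).2‖ ≤ c₂ * ‖e.1.snd‖

variable [BanachBundle E]

/-- The space `Γ(E)` of continuous sections, with pointwise addition. A section is given by its
values `σ l ∈ E l`; it is continuous as a map from `L` to the total space. -/
def Sections : AddSubgroup ((l : L) → E l) where
  carrier := {σ | Continuous (fun l => (point l (σ l) : BundleSpace E))}
  zero_mem' := by
    refine continuous_iff_continuousAt.2 ?_
    intro l
    refine (hasBasis_nhds_zero (E := E) l).tendsto_right_iff.2 ?_
    rintro ⟨U, ε⟩ ⟨hU, hε⟩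
    filter_upwards [hU] with m hm
    exact ⟨hm, by simpa using hε⟩
  add_mem' := by
    intro σ τ hσ hτ
    have h : Continuous (fun l => (⟨l, σ l, τ l⟩ : FiberProduct E)) :=
      continuous_induced_rng.2 (Continuous.prodMk hσ hτ)
    exact (continuous_add (E := E)).comp h
  neg_mem' := by
    intro σ hσ
    have h := (continuous_smul (E := E)).comp
      (Continuous.prodMk (continuous_const (y := (-1 : ℂ))) hσ)
    simpa [Function.comp_def] using h

/-- The pointwise action of continuous functions on continuous sections. -/
instance : SMul C(L, ℂ) (Sections E) where
  smul f σ := ⟨fun l => f l • σ.1 l,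
    (continuous_smul (E := E)).comp (Continuous.prodMk f.continuous σ.2)⟩

/-- `Γ(E)` as a module over the algebra `C(L)` of continuous complex-valued functions. -/
instance : Module C(L, ℂ) (Sections E) where
  one_smul σ := Subtype.ext (funext fun l => one_smul ℂ (σ.1 l))
  mul_smul f g σ := Subtype.ext (funext fun l => mul_smul (f l) (g l) (σ.1 l))
  smul_zero f := Subtype.ext (funext fun l => smul_zero (f l))
  smul_add f σ τ := Subtype.ext (funext fun l => smul_add (f l) (σ.1 l) (τ.1 l))
  add_smul f g σ := Subtype.ext (funext fun l => add_smul (f l) (g l) (σ.1 l))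
  zero_smul σ := Subtype.ext (funext fun l => zero_smul ℂ (σ.1 l))

end BanachBundle

end

set_option linter.unusedSectionVars false

/-! (a) ⇒ (b): local frames and their coordinate functionals, both multiplied by square roots of a
partition of unity, become finitely many global sections `S k` and functionals `μ k` with `∑ μ k σ •
S k = σ`. So `Γ(E)` is a retract of a finite free module.

(b) ⇒ (a): a splitting of a surjection from `C(L)^N` onto `Γ(E)` has to be carried over to the
fibers, which requires a continuous section through every vector. A Michael-type selection argument
shows that section values are dense in each fiber (`exists_section_near`): almost continuous
selections are glued by partitions of unity, refined, and converge uniformly because fibers are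
complete. As `Γ(E)` is finitely generated, these values also form a finite-dimensional, hence
closed, subspace, so they fill the fiber (`exists_section_eq`).

The open mapping theorem and a cutoff bound the splitting pointwise (`exists_pointwise_bound`). It
therefore induces maps `J l` and `S l` between `E l` and `ℂ^N` with `S l ∘ J l = id` and uniform
bounds (`exists_global_coordinates`). The idempotents `J l ∘ S l` depend continuously on `l`, and
nearby idempotents are conjugate; this yields the trivializations. -/

namespace BanachBundle

open scoped Topology
open BundleSpace Filter

variable {L : Type*} [TopologicalSpace L] {E : L → Type*}
  [∀ l, NormedAddCommGroup (E l)] [∀ l, NormedSpace ℂ (E l)] [∀ l, CompleteSpace (E l)]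
  [TopologicalSpace (BundleSpace E)]

/-! ### Limits in the total space and approximately continuous sections. -/

section Basic

variable [BanachBundle E]

theorem tendsto_fiberProduct_iff {α : Type*} {F : Filter α} {q : α → FiberProduct E}
    {l : L} {x y : E l} :
    Tendsto q F (𝓝 ⟨l, x, y⟩) ↔
      Tendsto (fun a => point (q a).base (q a).fst) F (𝓝 (point l x)) ∧
      Tendsto (fun a => point (q a).base (q a).snd) F (𝓝 (point l y)) := by
  rw [nhds_induced, tendsto_comap_iff, nhds_prod_eq, tendsto_prod_iff']
  rfl

theorem tendsto_add {α : Type*} {F : Filter α} {b : α → L} {u v : ∀ a, E (b a)}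
    {l : L} {x y : E l}
    (hu : Tendsto (fun a => point (b a) (u a)) F (𝓝 (point l x)))
    (hv : Tendsto (fun a => point (b a) (v a)) F (𝓝 (point l y))) :
    Tendsto (fun a => point (b a) (u a + v a)) F (𝓝 (point l (x + y))) :=
  ((continuous_add (E := E)).tendsto ⟨l, x, y⟩).comp
    (tendsto_fiberProduct_iff (q := fun a => ⟨b a, u a, v a⟩) |>.2 ⟨hu, hv⟩)

theorem tendsto_smul {α : Type*} {F : Filter α} {b : α → L} {c : α → ℂ} {v : ∀ a, E (b a)}
    {l : L} {z : ℂ} {x : E l} (hc : Tendsto c F (𝓝 z))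
    (hv : Tendsto (fun a => point (b a) (v a)) F (𝓝 (point l x))) :
    Tendsto (fun a => point (b a) (c a • v a)) F (𝓝 (point l (z • x))) :=
  ((continuous_smul (E := E)).tendsto (z, point l x)).comp (hc.prodMk_nhds hv)

theorem tendsto_sub {α : Type*} {F : Filter α} {b : α → L} {u v : ∀ a, E (b a)}
    {l : L} {x y : E l}
    (hu : Tendsto (fun a => point (b a) (u a)) F (𝓝 (point l x)))
    (hv : Tendsto (fun a => point (b a) (v a)) F (𝓝 (point l y))) :
    Tendsto (fun a => point (b a) (u a - v a)) F (𝓝 (point l (x - y))) := by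
  simpa [sub_eq_add_neg] using tendsto_add hu (tendsto_smul (tendsto_const_nhds (x := (-1 : ℂ))) hv)

theorem tendsto_base {α : Type*} {F : Filter α} {b : α → L} {u : ∀ a, E (b a)}
    {l : L} {x : E l} (hu : Tendsto (fun a => point (b a) (u a)) F (𝓝 (point l x))) :
    Tendsto b F (𝓝 l) :=
  ((continuous_proj (E := E)).tendsto (point l x)).comp hu

theorem eventually_norm_lt {α : Type*} {F : Filter α} {b : α → L} {u : ∀ a, E (b a)}
    {l : L} {x : E l} (hu : Tendsto (fun a => point (b a) (u a)) F (𝓝 (point l x)))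
    {r : ℝ} (hr : ‖x‖ < r) : ∀ᶠ a in F, ‖u a‖ < r :=
  hu.eventually (upperSemicontinuous_norm (E := E) (point l x) r hr)

theorem tendsto_zero {α : Type*} {F : Filter α} {b : α → L} {l : L} (hb : Tendsto b F (𝓝 l)) :
    Tendsto (fun a => point (b a) (0 : E (b a))) F (𝓝 (point l 0)) := by
  refine (hasBasis_nhds_zero (E := E) l).tendsto_right_iff.2 ?_
  rintro ⟨U, ε⟩ ⟨hU, hε⟩
  filter_upwards [hb hU] with m hm
  exact ⟨hm, by simpa using hε⟩

theorem tendsto_fst (l : L) (x y : E l) :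
    Tendsto (fun q : FiberProduct E => point q.base q.fst) (𝓝 ⟨l, x, y⟩) (𝓝 (point l x)) :=
  (tendsto_fiberProduct_iff.1 tendsto_id).1

theorem tendsto_snd (l : L) (x y : E l) :
    Tendsto (fun q : FiberProduct E => point q.base q.snd) (𝓝 ⟨l, x, y⟩) (𝓝 (point l y)) :=
  (tendsto_fiberProduct_iff.1 tendsto_id).2

theorem exists_open_of_eventually_fiberProduct {l : L} {x y : E l} {R : FiberProduct E → Prop}
    (h : ∀ᶠ q in 𝓝 (⟨l, x, y⟩ : FiberProduct E), R q) :
    ∃ A B : Set (BundleSpace E), IsOpen A ∧ IsOpen B ∧ point l x ∈ A ∧ point l y ∈ B ∧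
      ∀ q : FiberProduct E, point q.base q.fst ∈ A → point q.base q.snd ∈ B → R q := by
  rw [nhds_induced, eventually_comap] at h
  obtain ⟨A, B, hA, hxA, hB, hyB, hAB⟩ := mem_nhds_prod_iff'.1 h
  exact ⟨A, B, hA, hB, hxA, hyB, fun q h1 h2 => hAB (Set.mk_mem_prod h1 h2) q rfl⟩

/-- Openness of the projection: every vector near `x` has a companion near `y` over the same base
point. This replaces a local section through `y`, which is not yet available. -/
theorem eventually_exists_snd {l : L} {x y : E l} {R : FiberProduct E → Prop}
    (h : ∀ᶠ q in 𝓝 (⟨l, x, y⟩ : FiberProduct E), R q) :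
    ∀ᶠ e in 𝓝 (point l x), ∃ v : E e.proj, R ⟨e.proj, e.snd, v⟩ := by
  obtain ⟨A, B, hA, hB, hxA, hyB, hR⟩ := exists_open_of_eventually_fiberProduct h
  have h1 : proj '' B ∈ 𝓝 l :=
    (isOpenMap_proj (E := E) B hB).mem_nhds ⟨_, hyB, rfl⟩
  filter_upwards [hA.mem_nhds hxA, ((continuous_proj (E := E)).tendsto (point l x)) h1]
    with e he1 he2
  obtain ⟨⟨m, v⟩, hv, hm⟩ := he2
  obtain ⟨m', w⟩ := e
  obtain rfl : m = m' := hm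
  exact ⟨v, hR ⟨m, w, v⟩ he1 hv⟩

/-- Some thin neighborhood of a vector over `l` stays within `a + δ` of the (not necessarily
continuous) section `f`, for every `δ > 0`. -/
def OscLE (f : ∀ l, E l) (l : L) (a : ℝ) : Prop :=
  ∀ δ > 0, ∃ x : E l, ∀ᶠ e in 𝓝 (point l x), ‖e.snd - f e.proj‖ < a + δ

theorem OscLE.mono {f : ∀ l, E l} {l : L} {a b : ℝ} (h : OscLE f l a) (hab : a ≤ b) :
    OscLE f l b := fun δ hδ => by
  obtain ⟨x, hx⟩ := h δ hδ
  exact ⟨x, hx.mono fun e he => he.trans_le (by linarith)⟩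

theorem OscLE.perturb {f g : ∀ l, E l} {l : L} {a b : ℝ} (h : OscLE f l a)
    (hfg : ∀ᶠ m in 𝓝 l, ‖f m - g m‖ ≤ b) : OscLE g l (a + b) := fun δ hδ => by
  obtain ⟨x, hx⟩ := h δ hδ
  refine ⟨x, ?_⟩
  filter_upwards [hx, ((continuous_proj (E := E)).tendsto (point l x)).eventually hfg] with e h1 h2
  calc ‖e.snd - g e.proj‖ = ‖(e.snd - f e.proj) + (f e.proj - g e.proj)‖ := by simp
    _ ≤ _ := norm_add_le _ _
    _ < _ := by linarith

theorem oscLE_zero (l : L) : OscLE (0 : ∀ l, E l) l 0 := fun δ hδ => by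
  refine ⟨0, ?_⟩
  have := upperSemicontinuous_norm (E := E) (point l 0) δ (by simpa using hδ)
  filter_upwards [this] with e he
  simpa using he

/-- A vector `e` near `x + y` splits as `v + (e - v)` with `v` a companion near `x`; then `e - v` is
near `y`. -/
theorem OscLE.add {f g : ∀ l, E l} {l : L} {a b : ℝ} (hf : OscLE f l a) (hg : OscLE g l b) :
    OscLE (f + g) l (a + b) := fun δ hδ => by
  obtain ⟨x, hx⟩ := hf (δ / 2) (by positivity)
  obtain ⟨y, hy⟩ := hg (δ / 2) (by positivity)
  refine ⟨x + y, ?_⟩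
  have h1 := (tendsto_snd l (x + y) x).eventually hx
  have h2 := tendsto_sub (tendsto_fst l (x + y) x) (tendsto_snd l (x + y) x)
  rw [add_sub_cancel_left] at h2
  filter_upwards [eventually_exists_snd (h1.and (h2.eventually hy))] with e ⟨v, hv1, hv2⟩
  calc ‖e.snd - (f + g) e.proj‖ = ‖(v - f e.proj) + (e.snd - v - g e.proj)‖ := by
        congr 1; simp only [Pi.add_apply]; abel
    _ ≤ _ := norm_add_le _ _
    _ < (a + δ / 2) + (b + δ / 2) := add_lt_add hv1 hv2
    _ = _ := by ring

/-- Compare `e` near `φ l • x` with `φ • v` for a companion `v` near `x`. Nothing is divided by `φ`,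
so zeros of `φ` are harmless. -/
theorem OscLE.smul {f : ∀ l, E l} {l : L} {a : ℝ} (hf : OscLE f l a) {φ : L → ℂ}
    (hφ : ContinuousAt φ l) : OscLE (fun m => φ m • f m) l (‖φ l‖ * a) := fun δ hδ => by
  obtain ⟨η, hη, hη0⟩ : ∃ η : ℝ, η + (‖φ l‖ + η) * (a + η) < ‖φ l‖ * a + δ ∧ 0 < η := by
    have : Tendsto (fun η : ℝ => η + (‖φ l‖ + η) * (a + η)) (𝓝[>] 0)
        (𝓝 (0 + (‖φ l‖ + 0) * (a + 0))) :=
      (Continuous.tendsto (by fun_prop) 0).mono_left nhdsWithin_le_nhds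
    exact ((this.eventually_lt_const (by simpa using hδ)).and self_mem_nhdsWithin).exists
  obtain ⟨x, hx⟩ := hf η hη0
  refine ⟨φ l • x, ?_⟩
  have h1 := (tendsto_snd l (φ l • x) x).eventually hx
  have h2 := hφ.tendsto.comp (tendsto_base (tendsto_snd l (φ l • x) x))
  have h3 := tendsto_sub (tendsto_fst l (φ l • x) x)
    (tendsto_smul h2 (tendsto_snd l (φ l • x) x))
  have h4 := eventually_norm_lt h3 (r := η) (by simpa using hη0)
  have h5 := h2.norm.eventually_lt_const (show ‖φ l‖ < ‖φ l‖ + η by linarith)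
  filter_upwards [eventually_exists_snd (h1.and (h4.and h5))] with e ⟨v, hv1, hv2, hv3⟩
  simp only [Function.comp_apply] at hv1 hv2 hv3
  calc ‖e.snd - φ e.proj • f e.proj‖
      = ‖(e.snd - φ e.proj • v) + φ e.proj • (v - f e.proj)‖ := by
        congr 1; rw [smul_sub]; abel
    _ ≤ ‖e.snd - φ e.proj • v‖ + ‖φ e.proj • (v - f e.proj)‖ := norm_add_le _ _
    _ ≤ η + (‖φ l‖ + η) * (a + η) := by
        rw [norm_smul]
        gcongr
    _ < _ := hη

theorem oscLE_sum {ι : Type*} (t : Finset ι) {f : ι → ∀ l, E l} {l : L} {a : ι → ℝ}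
    (h : ∀ i ∈ t, OscLE (f i) l (a i)) : OscLE (∑ i ∈ t, f i) l (∑ i ∈ t, a i) := by
  classical
  induction t using Finset.induction_on with
  | empty => simpa using oscLE_zero l
  | insert i t hi ih =>
    rw [Finset.sum_insert hi, Finset.sum_insert hi]
    exact (h i (by simp)).add (ih fun j hj => h j (by simp [hj]))

/-- The center `x` may vary with `δ`, but evaluating at `x` itself shows that it is close to `f l`;
hence all vectors near `f l` are close to `f` in norm. Then `f m = v + (f m - v)` with `v` near `f
l` and a small remainder, and continuity of addition at `(f l, 0)` concludes. -/
theorem continuousAt_of_oscLE_zero {f : ∀ l, E l} {l : L} (h : OscLE f l 0) :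
    ContinuousAt (fun m => (point m (f m) : BundleSpace E)) l := by
  have key : ∀ ε > 0, ∀ᶠ e in 𝓝 (point l (f l)), ‖e.snd - f e.proj‖ < ε := by
    intro ε hε
    obtain ⟨x, hx⟩ := h (ε / 2) (by positivity)
    have hx0 : ‖f l - x‖ < ε / 2 := by
      simpa [norm_sub_rev] using hx.self_of_nhds
    have h1 := (tendsto_snd l (f l) x).eventually hx
    have h2 := eventually_norm_lt (tendsto_sub (tendsto_fst l (f l) x) (tendsto_snd l (f l) x)) hx0
    filter_upwards [eventually_exists_snd (h1.and h2)] with e ⟨v, hv1, hv2⟩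
    calc ‖e.snd - f e.proj‖ = ‖(e.snd - v) + (v - f e.proj)‖ := by simp
      _ ≤ _ := norm_add_le _ _
      _ < _ := by linarith
  refine tendsto_def.2 fun N hN => ?_
  have hadd := (continuous_add (E := E)).tendsto ⟨l, f l, 0⟩
  simp only [add_zero] at hadd
  obtain ⟨A, B, hA, hB, hxA, hyB, hR⟩ := exists_open_of_eventually_fiberProduct
    (hadd.eventually hN)
  obtain ⟨⟨U, ε⟩, ⟨hU, hε⟩, hUB⟩ := (hasBasis_nhds_zero (E := E) l).mem_iff.1 (hB.mem_nhds hyB)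
  have h1 := (isOpenMap_proj (E := E)).image_mem_nhds
    (Filter.inter_mem (hA.mem_nhds hxA) (key ε hε))
  filter_upwards [h1, hU] with m hm hmU
  obtain ⟨⟨m', v⟩, ⟨hvA, hv⟩, rfl⟩ := hm
  have := hR ⟨m', v, f m' - v⟩ hvA (hUB ⟨hmU, by simpa [norm_sub_rev] using hv⟩)
  change point m' (f m') ∈ N
  rwa [add_sub_cancel] at this

theorem oscLE_zero_of_continuousAt {f : ∀ l, E l} {l : L}
    (h : ContinuousAt (fun m => (point m (f m) : BundleSpace E)) l) : OscLE f l 0 := fun δ hδ => by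
  refine ⟨f l, ?_⟩
  have h1 : Tendsto (fun e : BundleSpace E => point e.proj (f e.proj)) (𝓝 (point l (f l)))
      (𝓝 (point l (f l))) :=
    h.tendsto.comp ((continuous_proj (E := E)).tendsto (point l (f l)))
  have h2 : Tendsto (fun e : BundleSpace E => point e.proj e.snd) (𝓝 (point l (f l)))
      (𝓝 (point l (f l))) := tendsto_id
  exact eventually_norm_lt (tendsto_sub h2 h1) (by simpa using hδ)

theorem continuous_of_forall_exists_near {f : ∀ l, E l}
    (h : ∀ ε > 0, ∃ g : ∀ l, E l, (∀ l, OscLE g l ε) ∧ ∀ l, ‖g l - f l‖ ≤ ε) :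
    Continuous (fun m => (point m (f m) : BundleSpace E)) := by
  refine continuous_iff_continuousAt.2 fun l => continuousAt_of_oscLE_zero fun δ hδ => ?_
  obtain ⟨g, hg, hgf⟩ := h (δ / 4) (by positivity)
  obtain ⟨x, hx⟩ := (hg l).perturb (Eventually.of_forall hgf) (δ / 2) (by positivity)
  exact ⟨x, hx.mono fun e he => he.trans_le (by linarith)⟩

/-- Around `x` there is an open set in which vectors of a common fiber differ by less than `ε`. Any
choice of vectors from it, continuous or not, does the job over its open image. -/
theorem exists_local_selection {l : L} (x : E l) {ε : ℝ} (hε : 0 < ε) {Q : BundleSpace E → Prop}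
    (hQ : ∀ᶠ e in 𝓝 (point l x), Q e) :
    ∃ (U : Set L) (s : ∀ m, E m), IsOpen U ∧ l ∈ U ∧ ‖s l - x‖ < ε ∧
      ∀ m ∈ U, OscLE s m ε ∧ Q (point m (s m)) := by
  classical
  have h := eventually_norm_lt (tendsto_sub (tendsto_fst l x x) (tendsto_snd l x x)) (r := ε)
    (by simpa using hε)
  obtain ⟨A, B, hA, hB, hxA, hxB, hR⟩ := exists_open_of_eventually_fiberProduct h
  obtain ⟨C, hCQ, hC, hxC⟩ := eventually_nhds_iff.1 hQ
  have hV : IsOpen (A ∩ B ∩ C) := (hA.inter hB).inter hC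
  have hs : ∀ m, ∃ v : E m, m ∈ proj '' (A ∩ B ∩ C) → point m v ∈ A ∩ B ∩ C := by
    intro m
    by_cases hm : m ∈ proj '' (A ∩ B ∩ C)
    · obtain ⟨⟨m', v⟩, hv, rfl⟩ := hm
      exact ⟨v, fun _ => hv⟩
    · exact ⟨0, fun h => absurd h hm⟩
  choose s hs using hs
  have hl : l ∈ proj '' (A ∩ B ∩ C) := ⟨point l x, ⟨⟨hxA, hxB⟩, hxC⟩, rfl⟩
  refine ⟨_, s, isOpenMap_proj _ hV, hl, hR ⟨l, s l, x⟩ (hs l hl).1.1 hxB,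
    fun m hm => ⟨fun δ hδ => ⟨s m, ?_⟩, hCQ _ (hs m hm).2⟩⟩
  filter_upwards [hV.mem_nhds (hs m hm)] with e he
  exact (hR ⟨e.proj, e.snd, s e.proj⟩ he.1.1 (hs _ ⟨e, he, rfl⟩).1.2).trans (by linarith)

end Basic

/-! ### Existence of continuous sections by successive approximation. -/

section Selections

variable [CompactSpace L] [T2Space L]

theorem exists_partitionOfUnity {ι : Type*} [Fintype ι] {U : ι → Set L} (hU : ∀ i, IsOpen (U i))
    (hcov : ∀ l, ∃ i, l ∈ U i) :
    ∃ φ : ι → C(L, ℝ), (∀ i l, 0 ≤ φ i l) ∧ (∀ l, ∑ i, φ i l = 1) ∧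
      ∀ i, tsupport (φ i) ⊆ U i := by
  obtain ⟨φ, hφ⟩ := PartitionOfUnity.exists_isSubordinate isClosed_univ U hU
    (fun l _ => Set.mem_iUnion.2 (hcov l))
  exact ⟨fun i => φ i, fun i l => φ.nonneg i l, fun l => by
    simpa [finsum_eq_sum_of_fintype] using φ.sum_eq_one (Set.mem_univ l), hφ⟩

variable [BanachBundle E]

/-- A convex combination along a partition of unity: the oscillation bounds average to `ε`, and
closed balls are convex. -/
theorem exists_glue {ι : Type*} [Fintype ι] {U : ι → Set L} (hU : ∀ i, IsOpen (U i))
    (hcov : ∀ l, ∃ i, l ∈ U i) {s : ι → ∀ l, E l} {ε : ℝ}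
    (hs : ∀ i, ∀ l ∈ U i, OscLE (s i) l ε) :
    ∃ g : ∀ l, E l, (∀ l, OscLE g l ε) ∧
      ∀ l (x : E l) (r : ℝ), (∀ i, l ∈ U i → ‖s i l - x‖ ≤ r) → ‖g l - x‖ ≤ r := by
  obtain ⟨φ, hφ0, hφ1, hφU⟩ := exists_partitionOfUnity hU hcov
  have hnorm : ∀ i l, ‖(φ i l : ℂ)‖ = φ i l := fun i l => by
    rw [Complex.norm_real, Real.norm_of_nonneg (hφ0 i l)]
  refine ⟨∑ i, fun l => (φ i l : ℂ) • s i l, fun l => ?_, fun l x r h => ?_⟩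
  · have : ∀ i ∈ Finset.univ, OscLE (fun l => (φ i l : ℂ) • s i l) l (φ i l * ε) := by
      intro i _
      by_cases hi : l ∈ tsupport (φ i)
      · have := (hs i l (hφU i hi)).smul (φ := fun l => (φ i l : ℂ))
          (by fun_prop)
        rwa [hnorm] at this
      · have h1 : φ i =ᶠ[𝓝 l] 0 := notMem_tsupport_iff_eventuallyEq.1 hi
        have h2 : φ i l = 0 := h1.self_of_nhds
        have := (oscLE_zero (E := E) l).perturb (g := fun l => (φ i l : ℂ) • s i l) (b := 0) (by
          filter_upwards [h1] with m hm
          simp [hm])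
        simpa [h2] using this
    have := oscLE_sum _ this
    rwa [← Finset.sum_mul, hφ1, one_mul] at this
  · have h1 : (∑ i, fun l => (φ i l : ℂ) • s i l : ∀ l, E l) l - x
        = ∑ i, (φ i l : ℂ) • (s i l - x) := by
      have : ∑ i, (φ i l : ℂ) = 1 := by exact_mod_cast hφ1 l
      simp only [smul_sub, Finset.sum_sub_distrib, ← Finset.sum_smul, this, one_smul,
        Finset.sum_apply]
    rw [h1]
    calc ‖∑ i, (φ i l : ℂ) • (s i l - x)‖ ≤ ∑ i, φ i l * r := by
          refine norm_sum_le_of_le _ fun i _ => ?_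
          rw [norm_smul, hnorm]
          by_cases hi : l ∈ U i
          · exact mul_le_mul_of_nonneg_left (h i hi) (hφ0 i l)
          · have : φ i l = 0 := by
              by_contra h0
              exact hi (hφU i (subset_tsupport _ h0))
            simp [this]
      _ = r := by rw [← Finset.sum_mul, hφ1, one_mul]

theorem exists_refine {f : ∀ l, E l} {ε : ℝ} (hε : 0 < ε) (hf : ∀ l, OscLE f l ε) :
    ∃ g : ∀ l, E l, (∀ l, OscLE g l (ε / 2)) ∧ ∀ l, ‖g l - f l‖ ≤ 2 * ε := by
  have h1 : ∀ l, ∃ (U : Set L) (s : ∀ m, E m), IsOpen U ∧ l ∈ U ∧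
      ∀ m ∈ U, OscLE s m (ε / 2) ∧ ‖s m - f m‖ < 2 * ε := fun l => by
    -- Slack `δ = ε` in `OscLE` is the origin of the displacement bound `ε + ε`.
    obtain ⟨x, hx⟩ := hf l ε hε
    obtain ⟨U, s, hU, hl, -, h⟩ := exists_local_selection x (half_pos hε) hx
    exact ⟨U, s, hU, hl, fun m hm => ⟨(h m hm).1, by linarith [(h m hm).2]⟩⟩
  choose U s hU hlU hs using h1
  obtain ⟨t, ht⟩ := CompactSpace.elim_nhds_subcover U fun l => (hU l).mem_nhds (hlU l)
  obtain ⟨g, hg1, hg2⟩ := exists_glue (ι := t) (U := fun i => U i) (s := fun i => s i)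
    (fun i => hU i) (fun l => by
      have : l ∈ ⋃ x ∈ t, U x := ht ▸ Set.mem_univ l
      simpa using this) (fun i l hl => (hs i l hl).1)
  exact ⟨g, hg1, fun l => hg2 l _ _ fun i hi => (hs i l hi).2.le⟩

theorem exists_approx_selection {l : L} (x : E l) {ε : ℝ} (hε : 0 < ε) :
    ∃ f : ∀ m, E m, (∀ m, OscLE f m ε) ∧ ‖f l - x‖ ≤ ε := by
  obtain ⟨U, s, hU, hl, hsx, hs⟩ := exists_local_selection x hε (Q := fun _ => True)
    (Eventually.of_forall fun _ => trivial)
  -- The zero section is used on the complement of `l`, so at `l` only `s` contributes.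
  obtain ⟨g, hg1, hg2⟩ := exists_glue (E := E) (ι := Bool) (U := fun b => if b then U else {l}ᶜ)
    (s := fun b => if b then s else 0) (ε := ε)
    (by rintro (_ | _) <;> simp [hU])
    (fun m => by
      by_cases hm : m = l
      · exact ⟨true, by simpa [hm] using hl⟩
      · exact ⟨false, by simpa using hm⟩)
    (by
      rintro (_ | _) m hm
      · simpa using (oscLE_zero m).mono hε.le
      · simpa using (hs m (by simpa using hm)).1)
  refine ⟨g, hg1, hg2 l x ε ?_⟩
  rintro (_ | _) hi
  · simp at hi
  · simpa using hsx.le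

/-- The values of continuous sections are dense in every fiber. -/
theorem exists_section_near {l : L} (x : E l) {ε : ℝ} (hε : 0 < ε) :
    ∃ σ : Sections E, ‖σ.1 l - x‖ ≤ ε := by
  -- The refinement steps move by `2c / 2 ^ n`, in total `4c`, and the initial approximation at `l`
  -- costs another `c`.
  set c := ε / 5 with hc
  have hc0 : 0 < c := by positivity
  let X : ℕ → Type _ := fun n => {f : ∀ m, E m // ∀ m, OscLE f m (c / 2 ^ n)}
  have step : ∀ n (f : X n), ∃ g : X (n + 1), ∀ m, ‖g.1 m - f.1 m‖ ≤ 2 * (c / 2 ^ n) := by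
    intro n f
    obtain ⟨g, hg1, hg2⟩ := exists_refine (by positivity) f.2
    exact ⟨⟨g, fun m => by have := hg1 m; rwa [div_div, ← pow_succ] at this⟩, hg2⟩
  choose G hG using step
  obtain ⟨f₀, hf₀, hf₀x⟩ := exists_approx_selection x hc0
  let F : ∀ n, X n := fun n => Nat.rec ⟨f₀, by simpa using hf₀⟩ G n
  have hd : ∀ m n, dist ((F n).1 m) ((F (n + 1)).1 m) ≤ 4 * c / 2 / 2 ^ n := fun m n => by
    rw [dist_eq_norm, norm_sub_rev]
    exact (hG n (F n) m).trans_eq (by ring)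
  have hlim : ∀ m, ∃ y, Tendsto (fun n => (F n).1 m) atTop (𝓝 y) := fun m =>
    cauchySeq_tendsto_of_complete (cauchySeq_of_le_geometric_two (hd m))
  choose f hf using hlim
  have hF : ∀ m n, ‖(F n).1 m - f m‖ ≤ 4 * c / 2 ^ n := fun m n => by
    rw [← dist_eq_norm]
    exact dist_le_of_le_geometric_two_of_tendsto (hd m) (hf m) n
  refine ⟨⟨f, continuous_of_forall_exists_near fun δ hδ => ?_⟩, ?_⟩
  · have : Tendsto (fun n : ℕ => 4 * c / 2 ^ n) atTop (𝓝 0) :=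
      tendsto_const_nhds.div_atTop (tendsto_pow_atTop_atTop_of_one_lt one_lt_two)
    obtain ⟨n, hn⟩ := (this.eventually_le_const hδ).exists
    refine ⟨(F n).1, fun m => ((F n).2 m).mono (le_trans ?_ hn), fun m => (hF m n).trans hn⟩
    gcongr
    linarith
  · have h0 := hF l 0
    have : ‖f l - x‖ ≤ ‖(F 0).1 l - f l‖ + ‖f₀ l - x‖ := by
      rw [norm_sub_rev ((F 0).1 l)]
      calc ‖f l - x‖ = ‖(f l - (F 0).1 l) + (f₀ l - x)‖ := by
            congr 1; change _ = (f l - f₀ l) + _; abel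
        _ ≤ _ := norm_add_le _ _
    calc _ ≤ _ := this
      _ ≤ 4 * c / 2 ^ 0 + c := add_le_add h0 hf₀x
      _ = ε := by rw [hc]; ring

end Selections

/-! ### Local triviality implies finitely generated and projective. -/

section FiniteProjective

variable [BanachBundle E]

@[simp]
theorem coe_sections_add (σ τ : Sections E) (l : L) : (σ + τ).1 l = σ.1 l + τ.1 l := rfl

@[simp]
theorem coe_sections_sub (σ τ : Sections E) (l : L) : (σ - τ).1 l = σ.1 l - τ.1 l := rfl

@[simp]
theorem coe_sections_smul (f : C(L, ℂ)) (σ : Sections E) (l : L) : (f • σ).1 l = f l • σ.1 l := rfl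

@[simp]
theorem coe_sections_sum {ι : Type*} (t : Finset ι) (σ : ι → Sections E) (l : L) :
    (∑ i ∈ t, σ i).1 l = ∑ i ∈ t, (σ i).1 l := by
  classical
  induction t using Finset.induction_on with
  | empty => rfl
  | insert i t hi ih => rw [Finset.sum_insert hi, Finset.sum_insert hi, coe_sections_add, ih]

theorem LocallyTrivial.exists_local_frame (h : LocallyTrivial E) (l : L) :
    ∃ (U : Set L) (n : ℕ) (s : Fin n → ∀ m, E m) (lam : Fin n → ∀ m, E m →ₗ[ℂ] ℂ),
      IsOpen U ∧ l ∈ U ∧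
      (∀ i, ∀ m ∈ U, ContinuousAt (fun m => (point m (s i m) : BundleSpace E)) m) ∧
      (∀ i, ∀ e : BundleSpace E, e.proj ∈ U →
        ContinuousAt (fun e : BundleSpace E => lam i e.proj e.snd) e) ∧
      ∀ m ∈ U, ∀ v : E m, ∑ i, lam i m v • s i m = v := by
  classical
  obtain ⟨W, -, hW, n, Φ, hΦ1, hΦ2, -⟩ := h l
  choose A hA using hΦ2
  let e := EuclideanSpace.basisFun (Fin n) ℂ
  -- Functionals and frame are extended by zero off `W`; their continuity is claimed only over the
  -- interior of `W`.
  let lam : Fin n → ∀ m, E m →ₗ[ℂ] ℂ := fun i m =>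
    if hm : m ∈ W then e.toBasis.coord i ∘ₗ (A ⟨m, hm⟩).toLinearMap else 0
  let s : Fin n → ∀ m, E m := fun i m => if hm : m ∈ W then (A ⟨m, hm⟩).symm (e i) else 0
  have hsymm : ∀ (w : W) z, (Φ.symm (w, z)).1 = point w.1 ((A w).symm z) := fun w z => by
    have : Φ.symm (w, z) = ⟨point w.1 ((A w).symm z), w.2⟩ := by
      rw [Homeomorph.symm_apply_eq]
      exact Prod.ext (hΦ1 ⟨point w.1 ((A w).symm z), w.2⟩).symm (by rw [hA]; simp)
    rw [this]
  have hs : ∀ i, ContinuousOn (fun m => (point m (s i m) : BundleSpace E)) W := fun i => by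
    rw [continuousOn_iff_continuous_domRestrict]
    have : W.domRestrict (fun m => (point m (s i m) : BundleSpace E)) =
        fun w => (Φ.symm (w, e i)).1 := by
      ext1 w
      rw [hsymm]
      simp [s]
    rw [this]
    fun_prop
  have hlam : ∀ i, ContinuousOn (fun e : BundleSpace E => lam i e.proj e.snd)
      (proj ⁻¹' W : Set (BundleSpace E)) := fun i => by
    rw [continuousOn_iff_continuous_domRestrict]
    have : (proj ⁻¹' W : Set (BundleSpace E)).domRestrict (fun e => lam i e.proj e.snd) =
        fun w => (Φ w).2 i := by
      ext1 w
      have hw : w.1.proj ∈ W := w.2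
      have := hA ⟨w.1.proj, hw⟩ w.1.snd
      simp only [Set.domRestrict_apply, lam, hw, dite_true, LinearMap.comp_apply,
        LinearEquiv.coe_coe, ← this]
      rfl
    rw [this]
    have : Continuous fun w => (Φ w).2 := by fun_prop
    exact (EuclideanSpace.proj i).continuous.comp this
  refine ⟨interior W, n, s, lam, isOpen_interior, mem_interior_iff_mem_nhds.2 hW,
    fun i m hm => (hs i).continuousAt (mem_interior_iff_mem_nhds.1 hm),
    fun i e he => (hlam i).continuousAt
      ((continuous_proj (E := E)).continuousAt (mem_interior_iff_mem_nhds.1 he)), fun m hm v => ?_⟩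
  have hm' := interior_subset hm
  apply (A ⟨m, hm'⟩).injective
  simp only [lam, s, hm', dite_true, map_sum, map_smul, LinearEquiv.apply_symm_apply,
    LinearMap.comp_apply, LinearEquiv.coe_coe]
  simpa using e.sum_repr (A ⟨m, hm'⟩ v)

/-- Off `tsupport χ` the product is locally the zero section, so nothing is required of `s` outside
`U`. -/
theorem exists_cutoff_section {U : Set L} {s : ∀ m, E m}
    (hs : ∀ m ∈ U, ContinuousAt (fun m => (point m (s m) : BundleSpace E)) m)
    (χ : C(L, ℂ)) (hχ : tsupport χ ⊆ U) : ∃ σ : Sections E, ∀ m, σ.1 m = χ m • s m := by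
  refine ⟨⟨fun m => χ m • s m, continuous_iff_continuousAt.2 fun m => ?_⟩, fun m => rfl⟩
  by_cases hm : m ∈ tsupport χ
  · exact tendsto_smul χ.continuous.continuousAt (hs m (hχ hm))
  · have h1 : χ =ᶠ[𝓝 m] 0 := notMem_tsupport_iff_eventuallyEq.1 hm
    have h2 : (fun m => (point m (0 : E m) : BundleSpace E)) =ᶠ[𝓝 m]
        fun m => point m (χ m • s m) := by
      filter_upwards [h1] with x hx
      simp [hx]
    exact ContinuousAt.congr (tendsto_zero (b := fun m => m) tendsto_id) h2

theorem exists_cutoff_functional {U : Set L} {lam : ∀ m, E m →ₗ[ℂ] ℂ}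
    (hl : ∀ e : BundleSpace E, e.proj ∈ U →
      ContinuousAt (fun e : BundleSpace E => lam e.proj e.snd) e)
    (χ : C(L, ℂ)) (hχ : tsupport χ ⊆ U) :
    ∃ μ : Sections E →ₗ[C(L, ℂ)] C(L, ℂ), ∀ σ m, μ σ m = χ m * lam m (σ.1 m) := by
  refine ⟨{ toFun := fun σ => ⟨fun m => χ m * lam m (σ.1 m),
              continuous_iff_continuousAt.2 fun m => ?_⟩
            map_add' := fun σ τ => ?_
            map_smul' := fun f σ => ?_ }, fun σ m => rfl⟩
  · by_cases hm : m ∈ tsupport χ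
    · exact χ.continuous.continuousAt.mul
        (ContinuousAt.comp (f := fun m => (point m (σ.1 m) : BundleSpace E)) (hl _ (hχ hm))
          σ.2.continuousAt)
    · have h1 : χ =ᶠ[𝓝 m] 0 := notMem_tsupport_iff_eventuallyEq.1 hm
      refine ContinuousAt.congr (f := fun _ => (0 : ℂ)) continuousAt_const ?_
      filter_upwards [h1] with x hx
      simp [hx]
  · ext m
    simp [mul_add]
  · ext m
    simp [mul_left_comm]

variable [CompactSpace L] [T2Space L]

theorem LocallyTrivial.finite_and_projective (h : LocallyTrivial E) :
    Module.Finite C(L, ℂ) (Sections E) ∧ Module.Projective C(L, ℂ) (Sections E) := by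
  classical
  choose U n s lam hU hlU hs hlam hsum using h.exists_local_frame
  obtain ⟨t, ht⟩ := CompactSpace.elim_nhds_subcover U fun l => (hU l).mem_nhds (hlU l)
  obtain ⟨φ, hφ0, hφ1, hφU⟩ := exists_partitionOfUnity (ι := t) (U := fun i => U i)
    (fun i => hU i) (fun l => by
      have : l ∈ ⋃ x ∈ t, U x := ht ▸ Set.mem_univ l
      simpa using this)
  -- The cutoff enters once through the functional and once through the section; the two factors
  -- must multiply to `φ i`.
  let χ : t → C(L, ℂ) := fun i => ⟨fun l => (√(φ i l) : ℝ), by fun_prop⟩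
  have hχ : ∀ i, tsupport (χ i) ⊆ U i := fun i => by
    refine subset_trans (closure_mono fun l hl => ?_) (hφU i)
    rw [Function.mem_support] at hl ⊢
    contrapose! hl
    simp [χ, hl]
  choose S hS using fun (k : Σ i : t, Fin (n i)) =>
    exists_cutoff_section (hs k.1 k.2) (χ k.1) (hχ k.1)
  choose μ hμ using fun (k : Σ i : t, Fin (n i)) =>
    exists_cutoff_functional (hlam k.1 k.2) (χ k.1) (hχ k.1)
  have key : Fintype.linearCombination C(L, ℂ) S ∘ₗ LinearMap.pi μ = LinearMap.id := by
    refine LinearMap.ext fun σ => Subtype.ext (funext fun l => ?_)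
    have h1 : ∀ i : t, ∑ j, (χ i l * lam i j l (σ.1 l)) • (χ i l • s i j l) = (φ i l : ℂ) • σ.1 l := by
      intro i
      have hχ2 : χ i l * χ i l = φ i l := by
        simp only [χ, ContinuousMap.coe_mk]
        exact_mod_cast Real.mul_self_sqrt (hφ0 i l)
      by_cases hi : l ∈ U i
      · calc _ = (χ i l * χ i l) • ∑ j, lam i j l (σ.1 l) • s i j l := by
              rw [Finset.smul_sum]
              refine Finset.sum_congr rfl fun j _ => ?_
              simp only [smul_smul]
              congr 1
              ring
          _ = _ := by rw [hsum i l hi, hχ2]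
      · have h0 : φ i l = 0 := by
          by_contra h0
          exact hi (hφU i (subset_tsupport _ h0))
        have : χ i l = 0 := by simp [χ, h0]
        simp [this, h0]
    have h2 : ∑ i, (φ i l : ℂ) = 1 := by exact_mod_cast hφ1 l
    calc (Fintype.linearCombination C(L, ℂ) S (LinearMap.pi μ σ)).1 l
        = ∑ k : Σ i : t, Fin (n i), μ k σ l • (S k).1 l := by
          simp [Fintype.linearCombination_apply]
      _ = ∑ i : t, (φ i l : ℂ) • σ.1 l := by
          rw [Fintype.sum_sigma]
          simp only [hS, hμ, h1]
      _ = σ.1 l := by rw [← Finset.sum_smul, h2, one_smul]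
  refine ⟨Module.Finite.of_surjective (Fintype.linearCombination C(L, ℂ) S) fun σ =>
    ⟨LinearMap.pi μ σ, LinearMap.congr_fun key σ⟩, Module.Projective.of_split _ _ key⟩

end FiniteProjective

/-! ### The bundle as a direct summand of a trivial bundle. -/

section GlobalCoordinates

open scoped ENNReal

variable [BanachBundle E]

variable (E) in
/-- The bounded continuous sections, as a subspace of the Banach space of bounded sections. -/
def sectionsLp : Submodule ℂ (lp E ∞) where
  carrier := {f | Continuous fun l => (point l (f l) : BundleSpace E)}
  zero_mem' := (Sections E).zero_mem
  add_mem' hf hg := (Sections E).add_mem hf hg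
  smul_mem' c _ hf := ((ContinuousMap.const L c) • (⟨_, hf⟩ : Sections E)).2

/-- Uniform limits of continuous sections are continuous. The resulting completeness is needed for
the open mapping theorem. -/
theorem isClosed_sectionsLp : IsClosed (sectionsLp E : Set (lp E ∞)) := by
  refine isClosed_of_closure_subset fun f hf => continuous_of_forall_exists_near fun ε hε => ?_
  obtain ⟨g, hg, hfg⟩ := Metric.mem_closure_iff.1 hf ε hε
  refine ⟨g, fun l => (oscLE_zero_of_continuousAt (Continuous.continuousAt hg)).mono hε.le,
    fun l => ?_⟩
  have := lp.norm_apply_le_norm ENNReal.top_ne_zero (g - f) l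
  rw [dist_comm, dist_eq_norm] at hfg
  exact this.trans hfg.le

instance : CompleteSpace (sectionsLp E) := isClosed_sectionsLp.completeSpace_coe

theorem tendsto_sum {α ι : Type*} (t : Finset ι) {F : Filter α} {b : α → L}
    {u : ι → ∀ a, E (b a)} {l : L} {x : ι → E l} (hb : Tendsto b F (𝓝 l))
    (hu : ∀ i, Tendsto (fun a => point (b a) (u i a)) F (𝓝 (point l (x i)))) :
    Tendsto (fun a => point (b a) (∑ i ∈ t, u i a)) F (𝓝 (point l (∑ i ∈ t, x i))) := by
  classical
  induction t using Finset.induction_on with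
  | empty => simpa using tendsto_zero hb
  | insert i t hi ih =>
    simp only [Finset.sum_insert hi]
    exact tendsto_add (hu i) ih

variable [CompactSpace L]

theorem exists_norm_section_le (σ : Sections E) : ∃ C : ℝ, ∀ l, ‖σ.1 l‖ ≤ C := by
  have h : UpperSemicontinuous fun l => ‖σ.1 l‖ := fun l r hr =>
    σ.2.continuousAt.eventually (upperSemicontinuous_norm (E := E) (point l (σ.1 l)) r hr)
  obtain ⟨C, hC⟩ := (h.upperSemicontinuousOn Set.univ).bddAbove_of_isCompact isCompact_univ
  exact ⟨C, fun l => hC ⟨l, trivial, rfl⟩⟩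

theorem map_eq_sum {N : ℕ} {M : Type*} [AddCommMonoid M] [Module C(L, ℂ) M]
    (f : (Fin N → C(L, ℂ)) →ₗ[C(L, ℂ)] M) (x : Fin N → C(L, ℂ)) :
    f x = ∑ i, x i • f (Pi.single i 1) := by
  classical
  rw [LinearMap.pi_apply_eq_sum_univ f x]
  refine Finset.sum_congr rfl fun i _ => ?_
  congr 2
  ext1 j
  simp [Pi.single_apply, eq_comm]

/-- The open mapping theorem for sup norms: `f` is bounded because it is determined by the finitely
many bounded sections `f (Pi.single i 1)`. -/
theorem exists_bounded_preimage {N : ℕ} (f : (Fin N → C(L, ℂ)) →ₗ[C(L, ℂ)] Sections E)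
    (hf : Function.Surjective f) :
    ∃ C > 0, ∀ (σ : Sections E) (r : ℝ), 0 ≤ r → (∀ l, ‖σ.1 l‖ ≤ r) →
      ∃ x, f x = σ ∧ ‖x‖ ≤ C * r := by
  have hmem : ∀ σ : Sections E, Memℓp σ.1 ∞ := fun σ => by
    obtain ⟨C, hC⟩ := exists_norm_section_le σ
    exact memℓp_infty ⟨C, by rintro _ ⟨l, rfl⟩; exact hC l⟩
  choose C hC using fun i => exists_norm_section_le (f (Pi.single i 1))
  let T₀ : (Fin N → C(L, ℂ)) →ₗ[ℂ] sectionsLp E :=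
    { toFun := fun x => ⟨⟨(f x).1, hmem _⟩, (f x).2⟩
      map_add' := fun x y => Subtype.ext (Subtype.ext (by rw [map_add]; rfl))
      map_smul' := fun c x => Subtype.ext (Subtype.ext (by
        have : c • x = ContinuousMap.const L c • x := by
          ext i l
          simp
        rw [this, map_smul]
        rfl)) }
  have hT₀ : ∀ x, ‖T₀ x‖ ≤ (∑ i, |C i|) * ‖x‖ := fun x => by
    refine lp.norm_le_of_forall_le (by positivity) fun l => ?_
    change ‖(f x).1 l‖ ≤ _
    rw [map_eq_sum f x, coe_sections_sum, Finset.sum_mul]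
    refine norm_sum_le_of_le _ fun i _ => ?_
    rw [coe_sections_smul, norm_smul, mul_comm]
    gcongr
    · exact (hC i l).trans (le_abs_self _)
    · exact ((x i).norm_coe_le_norm l).trans (norm_le_pi_norm x i)
  let T := T₀.mkContinuous _ hT₀
  have hT : Function.Surjective T := fun y => by
    obtain ⟨x, hx⟩ := hf ⟨_, y.2⟩
    exact ⟨x, Subtype.ext (lp.ext (congrArg (fun σ : Sections E => σ.1) hx))⟩
  obtain ⟨C, hC0, hC⟩ := T.exists_preimage_norm_le hT
  refine ⟨C, hC0, fun σ r hr hσ => ?_⟩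
  obtain ⟨x, hx, hxn⟩ := hC ⟨⟨σ.1, hmem σ⟩, σ.2⟩
  refine ⟨x, Subtype.ext (congrArg (fun y : sectionsLp E => (y.1 : ∀ l, E l)) hx), hxn.trans ?_⟩
  gcongr
  exact lp.norm_le_of_forall_le hr hσ

variable [T2Space L]

/-- Open mapping bounds `h` only in sup norm. Multiplying `σ` by a cutoff `ψ` with `ψ l = 1` does
not change `h σ` at `l`, by `C(L)`-linearity, while upper semicontinuity of the norm lets the sup
norm of `ψ • σ` come arbitrarily close to `‖σ l‖`. -/
theorem exists_pointwise_bound {N : ℕ} (f : (Fin N → C(L, ℂ)) →ₗ[C(L, ℂ)] Sections E)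
    (hf : Function.Surjective f) (h : Sections E →ₗ[C(L, ℂ)] (Fin N → C(L, ℂ))) :
    ∃ K > 0, ∀ (σ : Sections E) l, ‖fun i => h σ i l‖ ≤ K * ‖σ.1 l‖ := by
  obtain ⟨C, hC0, hC⟩ := exists_bounded_preimage f hf
  set D := ∑ i, ‖h (f (Pi.single i 1))‖ with hD
  have hD0 : 0 ≤ D := by positivity
  have hbound : ∀ (σ : Sections E) (r : ℝ), 0 ≤ r → (∀ l, ‖σ.1 l‖ ≤ r) →
      ‖h σ‖ ≤ (D * C + 1) * r := fun σ r hr hσ => by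
    obtain ⟨x, rfl, hx⟩ := hC σ r hr hσ
    have h1 : ‖h (f x)‖ ≤ D * ‖x‖ := by
      rw [← LinearMap.comp_apply, map_eq_sum (h ∘ₗ f) x, hD, Finset.sum_mul]
      refine norm_sum_le_of_le _ fun i _ => ?_
      rw [mul_comm]
      refine (norm_smul_le _ _).trans ?_
      gcongr
      · exact norm_le_pi_norm x i
      · rfl
    calc _ ≤ _ := h1
      _ ≤ D * (C * r) := by gcongr
      _ ≤ _ := by nlinarith
  refine ⟨D * C + 1, by positivity, fun σ l => le_of_forall_pos_le_add fun δ hδ => ?_⟩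
  set K := D * C + 1
  have hK : 0 < K := by positivity
  have h1 : ∀ᶠ m in 𝓝 l, ‖σ.1 m‖ < ‖σ.1 l‖ + δ / K :=
    eventually_norm_lt (b := fun m => m) σ.2.continuousAt (by
      have : 0 < δ / K := by positivity
      linarith)
  obtain ⟨U, hU, hUo, hlU⟩ := eventually_nhds_iff.1 h1
  obtain ⟨φ, hφ0, hφ1, hφ⟩ := exists_continuous_zero_one_of_isClosed hUo.isClosed_compl
    (isClosed_singleton (x := l)) (by simpa using hlU)
  let ψ : C(L, ℂ) := ⟨fun m => (φ m : ℂ), by fun_prop⟩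
  have hψ : ∀ m, ‖ψ m‖ = φ m := fun m => by
    simp only [ψ, ContinuousMap.coe_mk, Complex.norm_real, Real.norm_of_nonneg (hφ m).1]
  have hψl : ψ l = 1 := by
    have : φ l = 1 := hφ1 rfl
    simp [ψ, this]
  have h2 := hbound (ψ • σ) (‖σ.1 l‖ + δ / K) (by positivity) fun m => by
    rw [coe_sections_smul, norm_smul, hψ]
    by_cases hm : m ∈ U
    · calc φ m * ‖σ.1 m‖ ≤ 1 * ‖σ.1 m‖ := by gcongr; exact (hφ m).2
        _ ≤ _ := by rw [one_mul]; exact (hU m hm).le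
    · have : φ m = 0 := hφ0 hm
      rw [this, zero_mul]
      positivity
  calc ‖fun i => h σ i l‖ ≤ ‖h (ψ • σ)‖ := by
        refine (pi_norm_le_iff_of_nonneg (norm_nonneg _)).2 fun i => ?_
        have : h σ i l = h (ψ • σ) i l := by simp [hψl]
        rw [this]
        exact ((h (ψ • σ) i).norm_coe_le_norm l).trans (norm_le_pi_norm _ i)
    _ ≤ K * (‖σ.1 l‖ + δ / K) := h2
    _ = _ := by field_simp

/-- The values at `l` of all sections are the span of the values of `N` generators:
finite-dimensional, hence closed, and dense by `exists_section_near`. -/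
theorem exists_section_eq {N : ℕ} {f : (Fin N → C(L, ℂ)) →ₗ[C(L, ℂ)] Sections E}
    (hf : Function.Surjective f) (l : L) (v : E l) : ∃ σ : Sections E, σ.1 l = v := by
  let S : (Fin N → ℂ) →ₗ[ℂ] E l := Fintype.linearCombination ℂ fun i => (f (Pi.single i 1)).1 l
  have hS : ∀ x : Fin N → C(L, ℂ), (f x).1 l = S fun i => x i l := fun x => by
    rw [map_eq_sum f x]
    simp [S, Fintype.linearCombination_apply]
  have hcl : IsClosed (LinearMap.range S : Set (E l)) := Submodule.closed_of_finiteDimensional _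
  have hv : v ∈ LinearMap.range S := by
    refine hcl.closure_subset (Metric.mem_closure_iff.2 fun ε hε => ?_)
    obtain ⟨σ, hσ⟩ := exists_section_near v (half_pos hε)
    obtain ⟨x, rfl⟩ := hf σ
    refine ⟨_, ⟨fun i => x i l, (hS x).symm⟩, ?_⟩
    rw [dist_comm, dist_eq_norm]
    linarith
  obtain ⟨c, rfl⟩ := hv
  exact ⟨f fun i => ContinuousMap.const L (c i), by rw [hS]; rfl⟩

/-- If the module of sections is finitely generated and projective, the bundle is a continuous
direct summand, with uniform bounds, of a trivial bundle of finite rank. -/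
theorem exists_global_coordinates [Module.Finite C(L, ℂ) (Sections E)]
    [Module.Projective C(L, ℂ) (Sections E)] :
    ∃ (N : ℕ) (J : ∀ l, E l →ₗ[ℂ] (Fin N → ℂ)) (S : ∀ l, (Fin N → ℂ) →ₗ[ℂ] E l) (K : ℝ),
      0 ≤ K ∧ (∀ l v, S l (J l v) = v) ∧ (∀ l v, ‖J l v‖ ≤ K * ‖v‖) ∧
      (∀ l c, ‖S l c‖ ≤ K * ‖c‖) ∧ Continuous (fun e : BundleSpace E => J e.proj e.snd) ∧
      Continuous (fun q : L × (Fin N → ℂ) => (point q.1 (S q.1 q.2) : BundleSpace E)) := by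
  obtain ⟨N, f, hf⟩ := Module.Finite.exists_fin' C(L, ℂ) (Sections E)
  obtain ⟨h, hfh⟩ := Module.projective_lifting_property f LinearMap.id hf
  obtain ⟨K, hK0, hK⟩ := exists_pointwise_bound f hf h
  choose τ hτ using exists_section_eq hf
  choose C hC using fun i => exists_norm_section_le (f (Pi.single i 1))
  -- By the pointwise bound, `h σ` at `l` depends only on `σ l`, so `h` descends to the fibers and
  -- the arbitrary choice `τ` is immaterial.
  have hwd : ∀ (σ : Sections E) l v, σ.1 l = v → ∀ i, h (τ l v) i l = h σ i l := by
    intro σ l v hv i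
    have h1 := hK (τ l v - σ) l
    rw [coe_sections_sub, hτ, hv, sub_self, norm_zero, mul_zero] at h1
    have h2 := congrFun (norm_le_zero_iff.1 h1) i
    rw [map_sub] at h2
    exact sub_eq_zero.1 h2
  let J : ∀ l, E l →ₗ[ℂ] (Fin N → ℂ) := fun l =>
    { toFun := fun v i => h (τ l v) i l
      map_add' := fun v w => funext fun i => by
        rw [hwd (τ l v + τ l w) l (v + w) (by simp [hτ]), map_add]
        rfl
      map_smul' := fun c v => funext fun i => by
        rw [hwd (ContinuousMap.const L c • τ l v) l (c • v) (by simp [hτ]), map_smul]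
        rfl }
  have hJ : ∀ (σ : Sections E) l, J l (σ.1 l) = fun i => h σ i l := fun σ l =>
    funext fun i => hwd σ l _ rfl i
  let S : ∀ l, (Fin N → ℂ) →ₗ[ℂ] E l := fun l =>
    Fintype.linearCombination ℂ fun i => (f (Pi.single i 1)).1 l
  have hJK : ∀ l v, ‖J l v‖ ≤ K * ‖v‖ := fun l v => by
    have := hK (τ l v) l
    rwa [hτ] at this
  refine ⟨N, J, S, max K (∑ i, |C i|), by positivity, fun l v => ?_, fun l v => ?_, fun l c => ?_,
    ?_, ?_⟩
  · have h1 : (f (h (τ l v))).1 l = v := by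
      rw [← LinearMap.comp_apply, hfh, LinearMap.id_apply, hτ]
    rw [map_eq_sum f] at h1
    simpa [S, J, Fintype.linearCombination_apply] using h1
  · refine (hJK l v).trans ?_
    gcongr
    exact le_max_left _ _
  · calc ‖S l c‖ ≤ (∑ i, |C i|) * ‖c‖ := by
          rw [Fintype.linearCombination_apply, Finset.sum_mul]
          refine norm_sum_le_of_le _ fun i _ => ?_
          rw [norm_smul, mul_comm]
          gcongr
          · exact (hC i l).trans (le_abs_self _)
          · exact norm_le_pi_norm c i
      _ ≤ _ := by
          gcongr
          exact le_max_right _ _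
  -- Subtract the section `σ` through `e`: along `σ` the map `J` is given by the continuous
  -- functions `h σ i`, and the remainder has norm tending to `0`, which the bound `K` transfers to
  -- `J`.
  · refine continuous_iff_continuousAt.2 fun e => ?_
    set σ := τ e.proj e.snd with hσ
    have hp : Tendsto (proj : BundleSpace E → L) (𝓝 e) (𝓝 e.proj) :=
      (continuous_proj (E := E)).continuousAt
    have h1 : Tendsto (fun e' : BundleSpace E => J e'.proj (σ.1 e'.proj)) (𝓝 e)
        (𝓝 (J e.proj (σ.1 e.proj))) := by
      simp only [hJ]
      exact tendsto_pi_nhds.2 fun i => ((h σ i).continuous.tendsto _).comp hp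
    have h2 : Tendsto (fun e' : BundleSpace E => J e'.proj (e'.snd - σ.1 e'.proj)) (𝓝 e)
        (𝓝 0) := by
      have h3 : Tendsto (fun e' : BundleSpace E => ‖e'.snd - σ.1 e'.proj‖) (𝓝 e) (𝓝 0) := by
        have h4 : Tendsto (fun e' : BundleSpace E => point e'.proj (σ.1 e'.proj)) (𝓝 e)
            (𝓝 (point e.proj (σ.1 e.proj))) :=
          (σ.2.tendsto e.proj).comp hp
        have h5 : Tendsto (fun e' : BundleSpace E => point e'.proj e'.snd) (𝓝 e)
            (𝓝 (point e.proj e.snd)) := tendsto_id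
        have h6 := tendsto_sub h5 h4
        refine tendsto_order.2 ⟨fun a ha => Eventually.of_forall fun e' =>
          ha.trans_le (norm_nonneg _), fun a ha => eventually_norm_lt h6 ?_⟩
        rw [hσ, hτ]
        simpa using ha
      refine squeeze_zero_norm (fun e' => hJK _ _) ?_
      simpa using h3.const_mul K
    have h3 := h1.add h2
    simp only [← map_add, add_sub_cancel, add_zero] at h3
    rw [hσ, hτ] at h3
    exact h3
  · refine continuous_iff_continuousAt.2 fun q => ?_
    simp only [S, Fintype.linearCombination_apply]
    refine tendsto_sum (b := fun q : L × (Fin N → ℂ) => q.1) _ continuousAt_fst fun i =>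
      tendsto_smul (b := fun q : L × (Fin N → ℂ) => q.1) (c := fun q => q.2 i)
        ((continuous_apply i).comp continuous_snd).continuousAt
        (((f (Pi.single i 1)).2.tendsto q.1).comp continuousAt_fst)

end GlobalCoordinates

/-! ### Trivializations from a continuous family of idempotents. -/

theorem exists_factor_of_idempotent {X : Type*} [NormedAddCommGroup X] [NormedSpace ℂ X]
    [FiniteDimensional ℂ X] {P : X →L[ℂ] X} (hP : P * P = P) :
    ∃ (n : ℕ) (B : X →L[ℂ] EuclideanSpace ℂ (Fin n)) (D : EuclideanSpace ℂ (Fin n) →L[ℂ] X),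
      (∀ z, B (D z) = z) ∧ ∀ x, D (B x) = P x := by
  let V := LinearMap.range P.toLinearMap
  let A : V ≃ₗ[ℂ] EuclideanSpace ℂ (Fin (Module.finrank ℂ V)) :=
    LinearEquiv.ofFinrankEq _ _ (by simp)
  refine ⟨_, LinearMap.toContinuousLinearMap (A.toLinearMap ∘ₗ P.toLinearMap.rangeRestrict),
    LinearMap.toContinuousLinearMap (V.subtype ∘ₗ A.symm.toLinearMap), fun z => ?_, fun x => ?_⟩
  · have : P.toLinearMap.rangeRestrict (A.symm z) = A.symm z := by
      obtain ⟨x, hx⟩ := (A.symm z).2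
      refine Subtype.ext ?_
      change P (A.symm z).1 = _
      rw [← hx]
      exact congrArg (fun T : X →L[ℂ] X => T x) hP
    simp [this]
  · simp

section LocallyTrivial

variable [BanachBundle E] [CompactSpace L] [T2Space L]

/-- The map `J m` identifies `E m` with the range of `P m = J m ∘ S m`; an invertible `U m` carries
this range onto that of `P l`, which is a copy of `ℂⁿ`. -/
theorem locallyTrivial_of_finite_of_projective [Module.Finite C(L, ℂ) (Sections E)]
    [Module.Projective C(L, ℂ) (Sections E)] : LocallyTrivial E := by
  obtain ⟨N, J, S, K, hK0, hSJ, hJK, hSK, hJc, hSc⟩ := exists_global_coordinates (E := E)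
  intro l
  let P : L → (Fin N → ℂ) →L[ℂ] (Fin N → ℂ) := fun m =>
    LinearMap.toContinuousLinearMap (J m ∘ₗ S m)
  have hPa : ∀ m c, P m c = J m (S m c) := fun m c => rfl
  have hPP : ∀ m, P m * P m = P m := fun m => by
    ext1 c
    simp only [mul_apply_eq_comp, hPa, hSJ]
  have hPc : Continuous P := continuous_clm_apply.2 fun c =>
    hJc.comp (hSc.comp (Continuous.prodMk continuous_id continuous_const))
  -- The standard intertwiner of two idempotents: `U m * P m = P l * U m`. It equals `1` at `m = l`,
  -- hence is invertible nearby.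
  let U : L → (Fin N → ℂ) →L[ℂ] (Fin N → ℂ) := fun m => P l * P m + (1 - P l) * (1 - P m)
  have hUc : Continuous U := by fun_prop
  have hUl : U l = 1 := by
    have := hPP l
    simp only [U, mul_sub, sub_mul, this, one_mul, mul_one]
    abel
  have hUP : ∀ m, U m * P m = P l * U m := fun m => by
    simp only [U, add_mul, mul_add, sub_mul, mul_sub, mul_assoc, hPP, one_mul, mul_one]
    simp only [← mul_assoc, hPP]
    abel
  obtain ⟨W, hW, hlW, hWU⟩ := exists_compact_subset
    (Units.isOpen.preimage hUc) (show l ∈ U ⁻¹' {x | IsUnit x} by simp [hUl])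
  let V : L → (Fin N → ℂ) →L[ℂ] (Fin N → ℂ) := fun m => Ring.inverse (U m)
  have hVU : ∀ m ∈ W, ∀ c, V m (U m c) = c := fun m hm c =>
    congrArg (fun T : (Fin N → ℂ) →L[ℂ] (Fin N → ℂ) => T c) (Ring.inverse_mul_cancel _ (hWU hm))
  have hUV : ∀ m ∈ W, ∀ c, U m (V m c) = c := fun m hm c =>
    congrArg (fun T : (Fin N → ℂ) →L[ℂ] (Fin N → ℂ) => T c) (Ring.mul_inverse_cancel _ (hWU hm))
  have hVc : ContinuousOn V W := fun m hm => by
    obtain ⟨u, hu⟩ := hWU hm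
    have h1 := NormedRing.inverse_continuousAt u
    rw [hu] at h1
    exact (ContinuousAt.comp h1 hUc.continuousAt).continuousWithinAt
  obtain ⟨M, hM⟩ := hW.exists_bound_of_continuousOn hUc.continuousOn
  obtain ⟨M', hM'⟩ := hW.exists_bound_of_continuousOn hVc
  obtain ⟨n, B, D, hBD, hDB⟩ := exists_factor_of_idempotent (hPP l)
  have hleft : ∀ m ∈ W, ∀ v, S m (V m (D (B (U m (J m v))))) = v := fun m hm v => by
    have h1 : P l (U m (J m v)) = U m (P m (J m v)) :=
      congrArg (fun T : (Fin N → ℂ) →L[ℂ] (Fin N → ℂ) => T (J m v)) (hUP m).symm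
    rw [hDB, h1, hVU m hm, hPa, hSJ, hSJ]
  have hright : ∀ m ∈ W, ∀ z, B (U m (J m (S m (V m (D z))))) = z := fun m hm z => by
    have h1 : U m (P m (V m (D z))) = P l (U m (V m (D z))) :=
      congrArg (fun T : (Fin N → ℂ) →L[ℂ] (Fin N → ℂ) => T (V m (D z))) (hUP m)
    rw [← hPa, h1, hUV m hm, ← hDB, hBD, hBD]
  let A : ∀ w : W, E w ≃ₗ[ℂ] EuclideanSpace ℂ (Fin n) := fun w =>
    { B.toLinearMap ∘ₗ (U w).toLinearMap ∘ₗ J w with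
      invFun := fun z => S w (V w (D z))
      left_inv := hleft w w.2
      right_inv := hright w w.2 }
  have hA : ∀ (w : W) v, A w v = B (U w (J w v)) := fun w v => rfl
  have hVc' : Continuous fun w : W => V w := continuousOn_iff_continuous_domRestrict.1 hVc
  let Φ : {e : BundleSpace E // e.proj ∈ W} ≃ₜ W × EuclideanSpace ℂ (Fin n) :=
    { toFun := fun e => (⟨e.1.proj, e.2⟩, A ⟨e.1.proj, e.2⟩ e.1.snd)
      invFun := fun q => ⟨point q.1.1 ((A q.1).symm q.2), q.1.2⟩
      left_inv := fun e => Subtype.ext (by simp)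
      right_inv := fun q => by simp
      continuous_toFun := by
        have h1 : Continuous fun e : {e : BundleSpace E // e.proj ∈ W} => e.1.proj :=
          (continuous_proj (E := E)).comp continuous_subtype_val
        refine (h1.subtype_mk _).prodMk ?_
        simp only [hA]
        exact B.continuous.comp ((hUc.comp h1).clm_apply (hJc.comp continuous_subtype_val))
      continuous_invFun := by
        refine Continuous.subtype_mk (hSc.comp (Continuous.prodMk
          (continuous_subtype_val.comp continuous_fst)
          ((hVc'.comp continuous_fst).clm_apply (D.continuous.comp continuous_snd)))) _ }
  -- The summands `+ 1` keep both constants positive even when `K`, `B` or `D` vanishes, as happens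
  -- for `n = 0`.
  refine ⟨W, hW, mem_interior_iff_mem_nhds.1 hlW, n, Φ, fun e => rfl,
    fun w => ⟨A w, fun v => rfl⟩, (K * (|M'| * ‖D‖) + 1)⁻¹, ‖B‖ * (|M| * K) + 1,
    by positivity, by positivity, fun e => ?_⟩
  obtain ⟨⟨m, v⟩, hm⟩ := e
  change m ∈ W at hm
  change _ * ‖v‖ ≤ ‖B (U m (J m v))‖ ∧ ‖B (U m (J m v))‖ ≤ _ * ‖v‖
  constructor
  · rw [inv_mul_le_iff₀ (by positivity)]
    set z := B (U m (J m v)) with hz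
    calc ‖v‖ = ‖S m (V m (D z))‖ := by rw [hz, hleft m hm]
      _ ≤ K * (|M'| * (‖D‖ * ‖z‖)) := by
        refine (hSK m _).trans ?_
        gcongr
        refine ((V m).le_opNorm _).trans ?_
        gcongr
        · exact (hM' m hm).trans (le_abs_self _)
        · exact D.le_opNorm z
      _ ≤ (K * (|M'| * ‖D‖) + 1) * ‖z‖ := by nlinarith [norm_nonneg z]
  · calc ‖B (U m (J m v))‖ ≤ ‖B‖ * (|M| * (K * ‖v‖)) := by
          refine (B.le_opNorm _).trans ?_
          gcongr
          refine ((U m).le_opNorm _).trans ?_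
          gcongr
          · exact (hM m hm).trans (le_abs_self _)
          · exact hJK m v
      _ ≤ (‖B‖ * (|M| * K) + 1) * ‖v‖ := by nlinarith [norm_nonneg v]

end LocallyTrivial

end BanachBundle

theorem mainTheorem10 {L : Type*} [TopologicalSpace L] [CompactSpace L] [T2Space L]
    (E : L → Type*) [∀ l, NormedAddCommGroup (E l)] [∀ l, NormedSpace ℂ (E l)]
    [∀ l, CompleteSpace (E l)] [TopologicalSpace (BundleSpace E)] [BanachBundle E] :
    BanachBundle.LocallyTrivial E ↔
      Module.Finite C(L, ℂ) (BanachBundle.Sections E) ∧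
        Module.Projective C(L, ℂ) (BanachBundle.Sections E) :=
  ⟨fun h => h.finite_and_projective, fun ⟨_, _⟩ =>
    BanachBundle.locallyTrivial_of_finite_of_projective⟩
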